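/- Let $m$ be Lebesgue measure on $(0,1)$. For a measurable function $x:(0,1)\to\mathbb R$ let $$\mu(t;x)=\inf\{s\ge 0:\ m(\{u\in(0,1):|x(u)|>s\})\le t\},\qquad 0<t<1,$$ be its decreasing right-continuous rearrangement. For an increasing (i.e. nondecreasing) function $\varphi:[0,1)\to[0,1)$ let $\Lambda_\varphi$ be the set of all measurable $x:(0,1)\to\mathbb R$ (modulo equality almost everywhere) with $$\|x\|_{\Lambda_\varphi}:=\int_{(0,1)}\mu(s;x)\,d\varphi(s)<\infty,$$ where $d\varphi$ is the Lebesgue–Stieltjes measure of $\varphi$ on the open interval $(0,1)$. For $x\in L_1(0,1)$ let $$(Sx)(t)=\frac1t\int_0^t x(s)\,ds+\int_t^1\frac{x(s)}{s}\,ds,\qquad 0<t<1,$$ be the Calderón operator. **Theorem.** Let $\varphi:[0,1)\to[0,1)$ be an increasing concave function, not identically zero, with $\varphi(0+)=0$, and set $$\psi(u)=\inf_{1<w<1/u}\frac{\varphi(uw)}{1+\log w},\qquad u\in[0,1)$$ (with $1/0=\infty$); $\psi$ is again an increasing function from $[0,1)$ to $[0,1)$. Suppose that there is a constant $c$ such that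 $$\int_0^u\frac{\psi(t)}{t}\,dt+u\int_u^1\frac{\psi(t)}{t^2}\,dt\le c\,\varphi(u),\qquad u\in(0,1).$$ Then: (i) $\Lambda_\varphi\subset L_1(0,1)$ and the operator $S:\Lambda_\varphi\to\Lambda_\psi$ is bounded, i.e. there is a constant $C<\infty$ such that $Sx\in\Lambda_\psi$ and $\|Sx\|_{\Lambda_\psi}\le C\|x\|_{\Lambda_\varphi}$ for all $x\in\Lambda_\varphi$; (ii) for every $x\in\Lambda_\psi$ there is $y\in\Lambda_\varphi$ such that $\mu(t;x)\le (S\mu(\cdot\,;y))(t)$ for all $t\in(0,1)$ and $\|y\|_{\Lambda_\varphi}\le 8\|x\|_{\Lambda_\psi}$. -/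

import Mathlib

open Set MeasureTheory Filter Topology

open scoped ENNReal NNReal

noncomputable section

namespace LorentzCalderon

/-- `φ` restricts to an increasing (nondecreasing) function `[0,1) → [0,1)`.
The values of `φ` outside `[0,1)` are never used. -/
structure IsWeight (φ : ℝ → ℝ) : Prop where
  mapsTo : MapsTo φ (Ico 0 1) (Ico 0 1)
  mono : MonotoneOn φ (Ico 0 1)

/-- `ψ(u) = inf_{1 < w < 1/u} φ(u w) / (1 + log w)` for `u ∈ [0,1)`. The condition `w < 1/u` is
written `u * w < 1`, which for `u = 0` means that `w` is unrestricted above. -/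
def psi (φ : ℝ → ℝ) (u : ℝ) : ℝ :=
  sInf ((fun w : ℝ => φ (u * w) / (1 + Real.log w)) '' {w : ℝ | 1 < w ∧ u * w < 1})

/-- The decreasing right-continuous rearrangement `μ(t; x)` of `|x|`, for `x` on `(0,1)`. -/
def rearr (x : ℝ → ℝ) (t : ℝ) : ℝ :=
  sInf {s : ℝ | 0 ≤ s ∧ volume {u : ℝ | u ∈ Ioo (0 : ℝ) 1 ∧ s < |x u|} ≤ ENNReal.ofReal t}

/-- The Calderón operator `(Sx)(t) = (1/t) ∫_0^t x(s) ds + ∫_t^1 x(s)/s ds`. -/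
def calderon (x : ℝ → ℝ) (t : ℝ) : ℝ :=
  (1 / t) * (∫ s in (0 : ℝ)..t, x s) + ∫ s in t..(1 : ℝ), x s / s

/-- Extension of a weight to a function on `ℝ`, by `0` on `(-∞,0)` and by `1` on `[1,∞)`. -/
def extend (φ : ℝ → ℝ) (t : ℝ) : ℝ :=
  if t < 0 then 0 else if t < 1 then φ t else 1

theorem extend_monotone {φ : ℝ → ℝ} (h : IsWeight φ) : Monotone (extend φ) := by
  intro a b hab
  unfold extend
  split_ifs with h1 h2 h3 h4 h5 h6 h7
  · exact le_rfl
  · exact (h.mapsTo ⟨not_lt.1 h2, h3⟩).1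
  · exact zero_le_one
  · linarith
  · exact h.mono ⟨not_lt.1 h1, h4⟩ ⟨not_lt.1 h5, h6⟩ hab
  · exact (h.mapsTo ⟨not_lt.1 h1, h4⟩).2.le
  · linarith
  · linarith
  · exact le_rfl

/-- The Lebesgue–Stieltjes measure `dφ` on `(0,1)`. -/
def weightMeasure (φ : ℝ → ℝ) (h : IsWeight φ) : Measure ℝ :=
  (extend_monotone h).stieltjesFunction.measure.restrict (Ioo 0 1)

/-- `‖x‖_{Λ_φ} = ∫_0^1 μ(s; x) dφ(s)`, as an extended nonnegative number. -/
def lorentzNorm (φ : ℝ → ℝ) (h : IsWeight φ) (x : ℝ → ℝ) : ℝ≥0∞ :=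
  ∫⁻ s, ENNReal.ofReal (rearr x s) ∂(weightMeasure φ h)

/-- The Lorentz space `Λ_φ` on `(0,1)`: the measurable functions with finite Lorentz norm
(membership and norm depend only on the a.e. class of the function on `(0,1)`). -/
def lorentzSpace (φ : ℝ → ℝ) (h : IsWeight φ) : Set (ℝ → ℝ) :=
  {x | AEMeasurable x (volume.restrict (Ioo (0 : ℝ) 1)) ∧ lorentzNorm φ h x < ∞}

theorem psi_term_nonneg {φ : ℝ → ℝ} (h : IsWeight φ) {u w : ℝ} (hu : 0 ≤ u) (hw : 1 < w)
    (huw : u * w < 1) : 0 ≤ φ (u * w) / (1 + Real.log w) :=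
  div_nonneg (h.mapsTo ⟨mul_nonneg hu (by linarith), huw⟩).1
    (by linarith [Real.log_pos hw])

theorem psi_bddBelow {φ : ℝ → ℝ} (h : IsWeight φ) {u : ℝ} (hu : 0 ≤ u) :
    BddBelow ((fun w : ℝ => φ (u * w) / (1 + Real.log w)) '' {w : ℝ | 1 < w ∧ u * w < 1}) :=
  ⟨0, by rintro _ ⟨w, ⟨hw, huw⟩, rfl⟩; exact psi_term_nonneg h hu hw huw⟩

theorem psi_nonempty {u : ℝ} (hu : u ∈ Ico (0 : ℝ) 1) :
    ∃ w : ℝ, 1 < w ∧ u * w < 1 := by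
  refine ⟨2 / (1 + u), ?_, ?_⟩
  · rw [lt_div_iff₀ (by linarith [hu.1])]; linarith [hu.2]
  · rw [← mul_div_assoc, div_lt_one (by linarith [hu.1])]; linarith [hu.2]

/-- The function `ψ` again is an increasing function `[0,1) → [0,1)`. -/
theorem psi_isWeight {φ : ℝ → ℝ} (h : IsWeight φ) : IsWeight (psi φ) where
  mapsTo := by
    intro u hu
    obtain ⟨w, hw, huw⟩ := psi_nonempty hu
    refine ⟨?_, ?_⟩
    · apply Real.sInf_nonneg
      rintro _ ⟨w, ⟨hw, huw⟩, rfl⟩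
      exact psi_term_nonneg h hu.1 hw huw
    · have hm := h.mapsTo (x := u * w) ⟨mul_nonneg hu.1 (by linarith), huw⟩
      refine lt_of_le_of_lt (csInf_le (psi_bddBelow h hu.1) ⟨w, ⟨hw, huw⟩, rfl⟩) ?_
      exact lt_of_le_of_lt (div_le_self hm.1 (by linarith [Real.log_pos hw])) hm.2
  mono := by
    intro a ha b hb hab
    obtain ⟨w₀, hw₀⟩ := psi_nonempty hb
    refine le_csInf ⟨_, w₀, hw₀, rfl⟩ ?_
    rintro _ ⟨w, ⟨hw, hbw⟩, rfl⟩
    have haw : a * w ≤ b * w := mul_le_mul_of_nonneg_right hab (by linarith)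
    refine (csInf_le (psi_bddBelow h ha.1) ⟨w, ⟨hw, haw.trans_lt hbw⟩, rfl⟩).trans ?_
    exact div_le_div_of_nonneg_right
      (h.mono ⟨mul_nonneg ha.1 (by linarith), haw.trans_lt hbw⟩
        ⟨mul_nonneg hb.1 (by linarith), hbw⟩ haw) (by linarith [Real.log_pos hw])

end LorentzCalderon

end

/-! The operator `S` has the symmetric kernel `1 / max t s`, and both halves of the theorem reduce
to indicators of initial intervals.

Boundedness: by a Hardy–Littlewood argument `|Sx| ≤ S(μ(x))`, and the right side is decreasing, so
`μ(Sx) ≤ S(μ(x))`. Integrating against `dψ` and applying Fubini gives `∫ μ(s;x) K(s) ds` with `K(s)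
= ∫ (max t s)⁻¹ dψ(t)`. The superlevel sets of `μ(x)` are intervals `(0,d)`, so it suffices to
compare `K ds` with a multiple of `dφ` on each `(0,u)` (`lintegral_le_of_forall_Ioo`). Writing `1 /
max t s` as `∫ r⁻² dr` over `r > max t s` turns the mass `∫₀ᵘ K` into the left side of the
hypothesis plus at most `u` (`lintegral_weightMeasure_inv_max_le`), and concavity gives `u ≤ A
φ(u)`.

Majorant: on `(0,v)` one has `S 1_(0,v) = 1 + log(v/t)`. Hence `φ(uw)/(1 + log w)` is the cost of
reaching height `1` at `u` with a multiple of `1_(0,uw)`, and `ψ(u)` is the least such cost. A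
nearly optimal `w` handles one indicator at a loss of `4` (`exists_indicator_le_calderonL`).
Decomposing `μ(x)` into dyadic layers loses another factor `2`; summing the corresponding multiples
of indicators gives `y` and the constant `8`. -/

noncomputable section

namespace LorentzCalderon

/-! ### Distribution function and rearrangement -/

/-- The distribution function of `|x|` on `(0,1)`. -/
def distr (x : ℝ → ℝ) (s : ℝ) : ℝ≥0∞ :=
  volume {u : ℝ | u ∈ Ioo (0 : ℝ) 1 ∧ s < |x u|}

theorem distr_le_one (x : ℝ → ℝ) (s : ℝ) : distr x s ≤ 1 := by
  calc distr x s ≤ volume (Ioo (0 : ℝ) 1) := measure_mono fun u hu => hu.1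
    _ = 1 := by simp

theorem distr_ne_top (x : ℝ → ℝ) (s : ℝ) : distr x s ≠ ∞ :=
  ((distr_le_one x s).trans_lt ENNReal.one_lt_top).ne

theorem distr_antitone (x : ℝ → ℝ) : Antitone (distr x) :=
  fun _ _ hab => measure_mono fun _ hu => ⟨hu.1, hab.trans_lt hu.2⟩

theorem distr_eq_restrict (x : ℝ → ℝ) (s : ℝ) :
    distr x s = volume.restrict (Ioo (0 : ℝ) 1) {u | s < |x u|} := by
  rw [Measure.restrict_apply' measurableSet_Ioo, inter_comm]; rfl

theorem exists_distr_le {x : ℝ → ℝ} (hx : AEMeasurable x (volume.restrict (Ioo (0 : ℝ) 1)))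
    {t : ℝ} (ht : 0 < t) : ∃ s : ℝ, 0 ≤ s ∧ distr x s ≤ ENNReal.ofReal t := by
  have h := tendsto_measure_iInter_atTop (μ := volume.restrict (Ioo (0 : ℝ) 1))
    (s := fun n : ℕ => {u | (n : ℝ) < |x u|})
    (fun n => nullMeasurableSet_lt aemeasurable_const hx.abs)
    (fun m n hmn u (hu : (n : ℝ) < |x u|) => lt_of_le_of_lt (by exact_mod_cast hmn) hu)
    ⟨0, measure_ne_top _ _⟩
  have he : (⋂ n : ℕ, {u | (n : ℝ) < |x u|}) = ∅ := by
    ext u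
    obtain ⟨n, hn⟩ := exists_nat_ge |x u|
    simp only [mem_iInter, mem_ofPred_eq, mem_empty_iff_false, iff_false, not_forall, not_lt]
    exact ⟨n, hn⟩
  rw [he, measure_empty] at h
  obtain ⟨n, hn⟩ := (h.eventually_le_const (ENNReal.ofReal_pos.2 ht)).exists
  exact ⟨n, n.cast_nonneg, (distr_eq_restrict x n).trans_le hn⟩

/-- Right continuity of the distribution function, by continuity of measure from below. It is what
makes the inequality in `lt_rearr_iff` strict on both sides. -/
theorem exists_lt_distr {x : ℝ → ℝ} {s : ℝ} {a : ℝ≥0∞} (h : a < distr x s) :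
    ∃ s' > s, a < distr x s' := by
  obtain ⟨v, hv, hvs, hvt⟩ := exists_seq_strictAnti_tendsto s
  have hu : {u : ℝ | u ∈ Ioo (0 : ℝ) 1 ∧ s < |x u|}
      = ⋃ n, {u : ℝ | u ∈ Ioo (0 : ℝ) 1 ∧ v n < |x u|} := by
    ext u
    simp only [mem_ofPred_eq, mem_iUnion]
    constructor
    · rintro ⟨h1, h2⟩
      obtain ⟨n, hn⟩ := (hvt.eventually_lt_const h2).exists
      exact ⟨n, h1, hn⟩
    · rintro ⟨n, h1, h2⟩
      exact ⟨h1, (hvs n).trans h2⟩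
  have hm : Monotone fun n => {u : ℝ | u ∈ Ioo (0 : ℝ) 1 ∧ v n < |x u|} :=
    fun m n hmn u hu => ⟨hu.1, (hv.antitone hmn).trans_lt hu.2⟩
  rw [distr, hu, hm.measure_iUnion, lt_iSup_iff] at h
  obtain ⟨n, hn⟩ := h
  exact ⟨v n, hvs n, hn⟩

theorem rearr_nonneg (x : ℝ → ℝ) (t : ℝ) : 0 ≤ rearr x t :=
  Real.sInf_nonneg fun _ hs => hs.1

theorem rearr_le {x : ℝ → ℝ} {s t : ℝ} (hs : 0 ≤ s) (h : distr x s ≤ ENNReal.ofReal t) :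
    rearr x t ≤ s :=
  csInf_le ⟨0, fun _ hs => hs.1⟩ ⟨hs, h⟩

theorem lt_rearr_iff {x : ℝ → ℝ} (hx : AEMeasurable x (volume.restrict (Ioo (0 : ℝ) 1)))
    {s t : ℝ} (hs : 0 ≤ s) (ht : 0 < t) : s < rearr x t ↔ ENNReal.ofReal t < distr x s := by
  constructor
  · intro h
    by_contra! hc
    exact (rearr_le hs hc).not_gt h
  · intro h
    obtain ⟨s', hs', h'⟩ := exists_lt_distr h
    refine hs'.trans_le (le_csInf (exists_distr_le hx ht) ?_)
    rintro r ⟨-, hr⟩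
    by_contra! hc
    exact (h'.trans_le ((distr_antitone x hc.le).trans hr)).false

theorem rearr_antitoneOn {x : ℝ → ℝ} (hx : AEMeasurable x (volume.restrict (Ioo (0 : ℝ) 1))) :
    AntitoneOn (rearr x) (Ioi 0) := by
  intro a ha b hb hab
  by_contra! hc
  rw [lt_rearr_iff hx (rearr_nonneg x a) hb] at hc
  have := (lt_rearr_iff hx (rearr_nonneg x a) ha).2
    ((ENNReal.ofReal_le_ofReal hab).trans_lt hc)
  exact this.false

theorem rearr_superlevel {x : ℝ → ℝ} (hx : AEMeasurable x (volume.restrict (Ioo (0 : ℝ) 1)))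
    {s : ℝ} (hs : 0 ≤ s) :
    {t : ℝ | t ∈ Ioo (0 : ℝ) 1 ∧ s < rearr x t} = Ioo 0 (distr x s).toReal := by
  have h1 : (distr x s).toReal ≤ 1 := ENNReal.toReal_le_of_le_ofReal zero_le_one
    (by simpa using distr_le_one x s)
  ext t
  constructor
  · rintro ⟨h, h'⟩
    exact ⟨h.1, (ENNReal.ofReal_lt_iff_lt_toReal h.1.le (distr_ne_top x s)).1
      ((lt_rearr_iff hx hs h.1).1 h')⟩
  · rintro ⟨h, h'⟩
    exact ⟨⟨h, h'.trans_le h1⟩, (lt_rearr_iff hx hs h).2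
      ((ENNReal.ofReal_lt_iff_lt_toReal h.le (distr_ne_top x s)).2 h')⟩

/-- Where `|y|` exceeds `G t`, so does `G`, which by monotonicity happens only inside `(0,t)`. -/
theorem rearr_le_of_antitoneOn {y G : ℝ → ℝ} (hG : AntitoneOn G (Ioo 0 1))
    (hy : ∀ t ∈ Ioo (0 : ℝ) 1, |y t| ≤ G t) {t : ℝ} (ht : t ∈ Ioo (0 : ℝ) 1) :
    rearr y t ≤ G t := by
  refine rearr_le ((abs_nonneg _).trans (hy t ht)) ?_
  calc distr y (G t) ≤ volume (Ioo 0 t) := by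
        refine measure_mono ?_
        rintro u ⟨hu, hu'⟩
        refine ⟨hu.1, ?_⟩
        by_contra! hc
        exact ((hu'.trans_le (hy u hu)).trans_le (hG ht hu hc)).false
    _ = ENNReal.ofReal t := by simp

theorem aemeasurable_rearr {x : ℝ → ℝ} (hx : AEMeasurable x (volume.restrict (Ioo (0 : ℝ) 1)))
    (ν : Measure ℝ) : AEMeasurable (rearr x) (ν.restrict (Ioo (0 : ℝ) 1)) :=
  aemeasurable_restrict_of_antitoneOn measurableSet_Ioo
    ((rearr_antitoneOn hx).mono fun _ h => h.1)

/-! ### Comparison on initial intervals and Hardy–Littlewood inequalities -/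

/-- Comparison of two measures on initial intervals carries over to antitone functions whose
superlevel sets are open intervals. -/
theorem lintegral_le_of_forall_Ioo {ν₁ ν₂ : Measure ℝ} {f : ℝ → ℝ}
    (hf0 : ∀ s ∈ Ioo (0 : ℝ) 1, 0 ≤ f s) (hf : AntitoneOn f (Ioo 0 1))
    (hsup : ∀ r > 0, ∃ d ≤ 1, {s : ℝ | s ∈ Ioo (0 : ℝ) 1 ∧ r < f s} = Ioo 0 d)
    (h : ∀ u ∈ Ioo (0 : ℝ) 1, ν₁ (Ioo 0 u) ≤ ν₂ (Ioo 0 u)) :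
    ∫⁻ s in Ioo (0 : ℝ) 1, ENNReal.ofReal (f s) ∂ν₁
      ≤ ∫⁻ s in Ioo (0 : ℝ) 1, ENNReal.ofReal (f s) ∂ν₂ := by
  have key (ν : Measure ℝ) : ∫⁻ s in Ioo (0 : ℝ) 1, ENNReal.ofReal (f s) ∂ν
      = ∫⁻ r in Ioi 0, ν {s : ℝ | s ∈ Ioo (0 : ℝ) 1 ∧ r < f s} := by
    rw [lintegral_eq_lintegral_meas_lt]
    · refine lintegral_congr fun r => ?_
      rw [Measure.restrict_apply' measurableSet_Ioo, inter_comm]; rfl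
    · exact (ae_restrict_iff' measurableSet_Ioo).2 (ae_of_all _ hf0)
    · exact aemeasurable_restrict_of_antitoneOn measurableSet_Ioo hf
  -- A superlevel set may be all of `(0,1)`, which the hypothesis on `u < 1` reaches only by
  -- exhaustion.
  have h1 : ν₁ (Ioo 0 1) ≤ ν₂ (Ioo 0 1) := by
    obtain ⟨v, hv, hvs, hvt⟩ := exists_seq_strictMono_tendsto' (zero_lt_one' ℝ)
    have hu : Ioo (0 : ℝ) 1 = ⋃ n, Ioo 0 (v n) := by
      ext u
      simp only [mem_iUnion, mem_Ioo]
      constructor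
      · rintro ⟨h1, h2⟩
        obtain ⟨n, hn⟩ := (hvt.eventually_const_lt h2).exists
        exact ⟨n, h1, hn⟩
      · rintro ⟨n, h1, h2⟩
        exact ⟨h1, h2.trans (hvs n).2⟩
    have hm : Monotone fun n => Ioo (0 : ℝ) (v n) :=
      fun m n hmn => Ioo_subset_Ioo_right (hv.monotone hmn)
    rw [hu, hm.measure_iUnion, hm.measure_iUnion]
    exact iSup_mono fun n => h _ (hvs n)
  rw [key, key]
  refine setLIntegral_mono' measurableSet_Ioi fun r hr => ?_
  obtain ⟨d, hd, he⟩ := hsup r hr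
  rw [he]
  rcases hd.eq_or_lt with rfl | hd
  · exact h1
  · rcases le_or_gt d 0 with hd0 | hd0
    · simp [Ioo_eq_empty (not_lt.2 hd0)]
    · exact h d ⟨hd0, hd⟩

theorem lintegral_rearr_le {ν₁ ν₂ : Measure ℝ} {x : ℝ → ℝ}
    (hx : AEMeasurable x (volume.restrict (Ioo (0 : ℝ) 1)))
    (h : ∀ u ∈ Ioo (0 : ℝ) 1, ν₁ (Ioo 0 u) ≤ ν₂ (Ioo 0 u)) :
    ∫⁻ s in Ioo (0 : ℝ) 1, ENNReal.ofReal (rearr x s) ∂ν₁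
      ≤ ∫⁻ s in Ioo (0 : ℝ) 1, ENNReal.ofReal (rearr x s) ∂ν₂ := by
  refine lintegral_le_of_forall_Ioo (fun s _ => rearr_nonneg x s)
    ((rearr_antitoneOn hx).mono fun _ h => h.1) (fun r hr => ⟨_, ?_, rearr_superlevel hx hr.le⟩) h
  exact ENNReal.toReal_le_of_le_ofReal zero_le_one (by simpa using distr_le_one x r)

theorem inv_max_antitoneOn {t : ℝ} : AntitoneOn (fun s => (max t s)⁻¹) (Ioo 0 1) :=
  fun _ ha _ _ hab => inv_anti₀ (lt_max_of_lt_right ha.1) (max_le_max le_rfl hab)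

theorem lintegral_inv_max_le {ν₁ ν₂ : Measure ℝ} {t : ℝ} (ht : 0 < t)
    (h : ∀ u ∈ Ioo (0 : ℝ) 1, ν₁ (Ioo 0 u) ≤ ν₂ (Ioo 0 u)) :
    ∫⁻ s in Ioo (0 : ℝ) 1, ENNReal.ofReal (max t s)⁻¹ ∂ν₁
      ≤ ∫⁻ s in Ioo (0 : ℝ) 1, ENNReal.ofReal (max t s)⁻¹ ∂ν₂ := by
  refine lintegral_le_of_forall_Ioo (fun s _ => by positivity) inv_max_antitoneOn ?_ h
  intro r hr
  have hiff (s : ℝ) : r < (max t s)⁻¹ ↔ t < r⁻¹ ∧ s < r⁻¹ := by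
    rw [lt_inv_comm₀ hr (lt_max_of_lt_left ht), max_lt_iff]
  by_cases htr : t < r⁻¹
  · refine ⟨min 1 r⁻¹, min_le_left _ _, ?_⟩
    ext s
    simp only [hiff, mem_ofPred_eq, mem_Ioo, lt_min_iff]
    tauto
  · refine ⟨0, zero_le_one, ?_⟩
    ext s
    simp [hiff, htr]

/-- Truncated Hardy–Littlewood inequality. -/
theorem setLIntegral_abs_le_rearr {x : ℝ → ℝ}
    (hx : AEMeasurable x (volume.restrict (Ioo (0 : ℝ) 1))) {u : ℝ} (hu : u ≤ 1) :
    ∫⁻ s in Ioo 0 u, ENNReal.ofReal |x s| ≤ ∫⁻ s in Ioo 0 u, ENNReal.ofReal (rearr x s) := by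
  have hsub : Ioo 0 u ⊆ Ioo (0 : ℝ) 1 := Ioo_subset_Ioo_right hu
  rw [lintegral_eq_lintegral_meas_lt _ (ae_of_all _ fun s => abs_nonneg (x s))
      ((hx.mono_measure (Measure.restrict_mono_set _ hsub)).abs),
    lintegral_eq_lintegral_meas_lt _ (ae_of_all _ fun s => rearr_nonneg x s)
      ((aemeasurable_rearr hx volume).mono_measure (Measure.restrict_mono_set _ hsub))]
  refine setLIntegral_mono' measurableSet_Ioi fun r hr => ?_
  rw [Measure.restrict_apply' measurableSet_Ioo, Measure.restrict_apply' measurableSet_Ioo]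
  have he : {s | r < rearr x s} ∩ Ioo 0 u = Ioo 0 (min (distr x r).toReal u) := by
    have := rearr_superlevel hx (le_of_lt hr)
    ext s
    constructor
    · rintro ⟨h1, h2⟩
      have : s ∈ Ioo 0 (distr x r).toReal := this ▸ ⟨hsub h2, h1⟩
      exact ⟨this.1, lt_min this.2 h2.2⟩
    · rintro ⟨h1, h2⟩
      have h3 : s ∈ Ioo 0 (distr x r).toReal := ⟨h1, (lt_min_iff.1 h2).1⟩
      rw [← this] at h3
      exact ⟨h3.2, h1, (lt_min_iff.1 h2).2⟩
  rw [he, Real.volume_Ioo, sub_zero, ENNReal.ofReal_min, ENNReal.ofReal_toReal (distr_ne_top x r)]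
  refine le_min (measure_mono fun s hs => ⟨hsub hs.2, hs.1⟩) ?_
  exact (measure_mono inter_subset_right).trans (by simp)

/-- The kernel decreases in `s`, so it suffices to compare the measures `|x| ds` and `μ(s;x) ds` on
initial intervals, which is `setLIntegral_abs_le_rearr`. -/
theorem lintegral_abs_mul_inv_max_le {x : ℝ → ℝ}
    (hx : AEMeasurable x (volume.restrict (Ioo (0 : ℝ) 1))) {t : ℝ} (ht : 0 < t) :
    ∫⁻ s in Ioo (0 : ℝ) 1, ENNReal.ofReal |x s| * ENNReal.ofReal (max t s)⁻¹
      ≤ ∫⁻ s in Ioo (0 : ℝ) 1, ENNReal.ofReal (rearr x s) * ENNReal.ofReal (max t s)⁻¹ := by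
  have hk : AEMeasurable (fun s : ℝ => ENNReal.ofReal (max t s)⁻¹)
      (volume.restrict (Ioo (0 : ℝ) 1)) := by fun_prop
  have hm {f : ℝ → ℝ} (hf : AEMeasurable f (volume.restrict (Ioo (0 : ℝ) 1))) :
      ∫⁻ s in Ioo (0 : ℝ) 1, ENNReal.ofReal (f s) * ENNReal.ofReal (max t s)⁻¹
        = ∫⁻ s in Ioo (0 : ℝ) 1, ENNReal.ofReal (max t s)⁻¹
          ∂((volume.restrict (Ioo (0 : ℝ) 1)).withDensity fun s => ENNReal.ofReal (f s)) := by
    rw [restrict_withDensity measurableSet_Ioo, Measure.restrict_restrict measurableSet_Ioo,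
      inter_self, lintegral_withDensity_eq_lintegral_mul₀ hf.ennreal_ofReal hk]
    rfl
  rw [hm hx.abs, hm (aemeasurable_rearr hx volume)]
  refine lintegral_inv_max_le ht fun u hu => ?_
  rw [withDensity_apply _ measurableSet_Ioo, withDensity_apply _ measurableSet_Ioo,
    Measure.restrict_restrict measurableSet_Ioo,
    inter_eq_left.2 (Ioo_subset_Ioo_right hu.2.le)]
  exact setLIntegral_abs_le_rearr hx hu.2.le

/-! ### Mass of initial intervals under a weight -/

theorem weightMeasure_Ioo_le {φ : ℝ → ℝ} (h : IsWeight φ) {r : ℝ} (hr : r ∈ Ioo (0 : ℝ) 1) :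
    weightMeasure φ h (Ioo 0 r) ≤ ENNReal.ofReal (φ r) := by
  set F := (extend_monotone h).stieltjesFunction with hF
  have h0 : 0 ≤ F 0 := by
    rw [hF, Monotone.stieltjesFunction_eq]
    refine le_trans ?_ ((extend_monotone h).le_rightLim le_rfl)
    simpa [extend] using (h.mapsTo (x := 0) (by simp)).1
  have h1 : Function.leftLim F r ≤ φ r := by
    refine le_of_tendsto (F.mono.tendsto_leftLim r) ?_
    filter_upwards [self_mem_nhdsWithin] with s hs
    rw [hF, Monotone.stieltjesFunction_eq]
    refine ((extend_monotone h).rightLim_le hs).trans ?_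
    simp [extend, hr.1.not_gt, hr.2]
  calc weightMeasure φ h (Ioo 0 r) ≤ F.measure (Ioo 0 r) := Measure.restrict_apply_le _ _
    _ = ENNReal.ofReal (Function.leftLim F r - F 0) := F.measure_Ioo
    _ ≤ ENNReal.ofReal (φ r) := ENNReal.ofReal_le_ofReal (by linarith)

/-- The gap `r < u` is needed since a general weight, such as `psi φ`, may jump at `u`, and that
atom lies outside `(0,u)`. The limit `φ(0+) = 0` rules out mass lost at the origin. -/
theorem ofReal_le_weightMeasure_Ioo {φ : ℝ → ℝ} (h : IsWeight φ)
    (h0 : Tendsto φ (𝓝[>] 0) (𝓝 0)) {r u : ℝ} (hr : 0 < r) (hru : r < u) (hu : u ≤ 1) :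
    ENNReal.ofReal (φ r) ≤ weightMeasure φ h (Ioo 0 u) := by
  set F := (extend_monotone h).stieltjesFunction with hF
  have hF0 : F 0 ≤ 0 := by
    rw [hF, Monotone.stieltjesFunction_eq]
    refine ge_of_tendsto h0 ?_
    filter_upwards [Ioo_mem_nhdsGT zero_lt_one] with s hs
    refine ((extend_monotone h).rightLim_le hs.1).trans ?_
    simp [extend, hs.1.not_gt, hs.2]
  have hFr : φ r ≤ F r := by
    rw [hF, Monotone.stieltjesFunction_eq]
    refine le_trans ?_ ((extend_monotone h).le_rightLim le_rfl)
    simp [extend, hr.not_gt, hru.trans_le hu]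
  calc ENNReal.ofReal (φ r) ≤ ENNReal.ofReal (F r - F 0) := ENNReal.ofReal_le_ofReal (by linarith)
    _ = F.measure (Ioc 0 r) := (F.measure_Ioc _ _).symm
    _ ≤ weightMeasure φ h (Ioo 0 u) := by
      rw [weightMeasure, Measure.restrict_apply' measurableSet_Ioo]
      exact measure_mono fun s hs =>
        ⟨⟨hs.1, hs.2.trans_lt hru⟩, hs.1, hs.2.trans_lt (hru.trans_le hu)⟩

theorem weightMeasure_restrict {φ : ℝ → ℝ} (h : IsWeight φ) :
    (weightMeasure φ h).restrict (Ioo 0 1) = weightMeasure φ h := by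
  rw [weightMeasure, Measure.restrict_restrict measurableSet_Ioo, inter_self]

instance sfinite_weightMeasure {φ : ℝ → ℝ} (h : IsWeight φ) : SFinite (weightMeasure φ h) := by
  unfold weightMeasure; infer_instance

theorem weightMeasure_Iio_le_one {φ : ℝ → ℝ} (h : IsWeight φ) (r : ℝ) :
    weightMeasure φ h (Iio r) ≤ 1 := by
  set F := (extend_monotone h).stieltjesFunction with hF
  have h0 : 0 ≤ F 0 := by
    rw [hF, Monotone.stieltjesFunction_eq]
    refine le_trans ?_ ((extend_monotone h).le_rightLim le_rfl)
    simpa [extend] using (h.mapsTo (x := 0) (by simp)).1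
  have h1 : F 1 ≤ 1 := by
    rw [hF, Monotone.stieltjesFunction_eq]
    refine ((extend_monotone h).rightLim_le one_lt_two).trans ?_
    norm_num [extend]
  calc weightMeasure φ h (Iio r) ≤ F.measure (Ioc 0 1) := by
        rw [weightMeasure, Measure.restrict_apply' measurableSet_Ioo]
        exact measure_mono fun s hs => ⟨hs.2.1, hs.2.2.le⟩
    _ = ENNReal.ofReal (F 1 - F 0) := F.measure_Ioc _ _
    _ ≤ ENNReal.ofReal 1 := ENNReal.ofReal_le_ofReal (by linarith)
    _ = 1 := ENNReal.ofReal_one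

theorem weightMeasure_Iio_eq {φ : ℝ → ℝ} (h : IsWeight φ) (r : ℝ) :
    weightMeasure φ h (Iio r) = weightMeasure φ h (Ioo 0 r) := by
  rw [weightMeasure, Measure.restrict_apply' measurableSet_Ioo,
    Measure.restrict_apply' measurableSet_Ioo]
  congr 1
  ext s
  simp only [mem_inter_iff, mem_Iio, mem_Ioo]
  tauto

/-- A nonzero increasing concave function dominates a multiple of the identity. -/
theorem exists_le_mul_of_concaveOn {φ : ℝ → ℝ} (hφ : IsWeight φ) (hconc : ConcaveOn ℝ (Ico 0 1) φ)
    (hne : ∃ t ∈ Ico (0 : ℝ) 1, φ t ≠ 0) : ∃ A > 0, ∀ u ∈ Ico (0 : ℝ) 1, u ≤ A * φ u := by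
  obtain ⟨t, ht, hne⟩ := hne
  have hpos : 0 < φ t := lt_of_le_of_ne (hφ.mapsTo ht).1 hne.symm
  refine ⟨(φ t)⁻¹, inv_pos.2 hpos, fun u hu => ?_⟩
  rw [inv_mul_eq_div, le_div_iff₀ hpos]
  rcases le_total t u with htu | hut
  -- To the right of `t` monotonicity and `u < 1` suffice; to the left, `φ` lies above its chord
  -- from `0` to `t`.
  · have := hφ.mono ht hu htu
    nlinarith [hu.2]
  · rcases hu.1.eq_or_lt with rfl | hu0
    · simpa using (hφ.mapsTo hu).1
    have ht0 : 0 < t := hu0.trans_le hut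
    have hc := hconc.2 (show (0 : ℝ) ∈ Ico 0 1 by simp) ht
      (sub_nonneg.2 ((div_le_one ht0).2 hut)) (show 0 ≤ u / t by positivity) (by ring)
    have e : (1 - u / t) • (0 : ℝ) + (u / t) • t = u := by
      simp only [smul_eq_mul]; field_simp; ring
    rw [e] at hc
    have h0 := (hφ.mapsTo (x := 0) (by simp)).1
    have h1 : 0 ≤ (1 - u / t) * φ 0 :=
      mul_nonneg (sub_nonneg.2 ((div_le_one ht0).2 hut)) h0
    have h2 : u ≤ u / t := by rw [le_div_iff₀ ht0]; nlinarith [ht.2]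
    simp only [smul_eq_mul] at hc
    nlinarith

/-- Concavity makes `φ` continuous inside the interval, so `r` can tend to `u` in
`ofReal_le_weightMeasure_Ioo`. -/
theorem ofReal_le_weightMeasure_Ioo_of_concaveOn {φ : ℝ → ℝ} (hφ : IsWeight φ)
    (hconc : ConcaveOn ℝ (Ico 0 1) φ) (h0 : Tendsto φ (𝓝[>] 0) (𝓝 0)) {u : ℝ}
    (hu : u ∈ Ioo (0 : ℝ) 1) : ENNReal.ofReal (φ u) ≤ weightMeasure φ hφ (Ioo 0 u) := by
  have hc : ContinuousAt φ u := by
    have := (hconc.subset Ioo_subset_Ico_self (convex_Ioo 0 1)).continuousOn isOpen_Ioo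
    exact this.continuousAt (isOpen_Ioo.mem_nhds hu)
  have ht : Tendsto (fun r => ENNReal.ofReal (φ r)) (𝓝[<] u) (𝓝 (ENNReal.ofReal (φ u))) :=
    (ENNReal.continuous_ofReal.tendsto _).comp (hc.tendsto.mono_left nhdsWithin_le_nhds)
  refine le_of_tendsto ht ?_
  filter_upwards [Ioo_mem_nhdsLT hu.1] with r hr
  exact ofReal_le_weightMeasure_Ioo hφ h0 hr.1 hr.2 hu.2.le

/-! ### The Calderón operator through its kernel -/

theorem integrableOn_mul_inv_max {f : ℝ → ℝ} (hf : IntegrableOn f (Ioo 0 1)) {t : ℝ}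
    (ht : 0 < t) : IntegrableOn (fun s => f s * (max t s)⁻¹) (Ioo 0 1) := by
  refine hf.mul_bdd (c := t⁻¹) (by fun_prop) (ae_of_all _ fun s => ?_)
  have : 0 < max t s := lt_max_of_lt_left ht
  rw [Real.norm_of_nonneg (inv_nonneg.2 this.le)]
  exact inv_anti₀ ht (le_max_left _ _)

theorem calderon_eq_setIntegral {f : ℝ → ℝ} (hf : IntegrableOn f (Ioo 0 1)) {t : ℝ}
    (ht : t ∈ Ioo (0 : ℝ) 1) : calderon f t = ∫ s in Ioo (0 : ℝ) 1, f s * (max t s)⁻¹ := by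
  have hi := integrableOn_mul_inv_max hf ht.1
  have hI : IntervalIntegrable (fun s => f s * (max t s)⁻¹) volume 0 1 := by
    rw [intervalIntegrable_iff_integrableOn_Ioo_of_le zero_le_one]; exact hi
  have h1 : IntervalIntegrable (fun s => f s * (max t s)⁻¹) volume 0 t :=
    hI.mono_set (by
      rw [uIcc_of_le ht.1.le, uIcc_of_le zero_le_one]
      exact Icc_subset_Icc_right ht.2.le)
  have h2 : IntervalIntegrable (fun s => f s * (max t s)⁻¹) volume t 1 :=
    hI.mono_set (by
      rw [uIcc_of_le ht.2.le, uIcc_of_le zero_le_one]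
      exact Icc_subset_Icc_left ht.1.le)
  rw [← integral_Ioc_eq_integral_Ioo, ← intervalIntegral.integral_of_le zero_le_one,
    ← intervalIntegral.integral_add_adjacent_intervals h1 h2, calderon,
    ← intervalIntegral.integral_const_mul]
  congr 1
  · refine intervalIntegral.integral_congr fun s hs => ?_
    rw [uIcc_of_le ht.1.le] at hs
    simp only [max_eq_left hs.2]
    ring
  · refine intervalIntegral.integral_congr fun s hs => ?_
    rw [uIcc_of_le ht.2.le] at hs
    simp only [max_eq_right hs.1]
    rfl

/-- The Calderón operator on nonnegative functions with values in `[0,∞]`. -/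
def calderonL (f : ℝ → ℝ≥0∞) (t : ℝ) : ℝ≥0∞ :=
  ∫⁻ s in Ioo (0 : ℝ) 1, f s * ENNReal.ofReal (max t s)⁻¹

theorem ofReal_abs_calderon_le {x : ℝ → ℝ} (hx : IntegrableOn x (Ioo 0 1)) {t : ℝ}
    (ht : t ∈ Ioo (0 : ℝ) 1) :
    ENNReal.ofReal |calderon x t| ≤ calderonL (fun s => ENNReal.ofReal |x s|) t := by
  rw [calderon_eq_setIntegral hx ht, ← Real.norm_eq_abs, ofReal_norm]
  refine (enorm_integral_le_lintegral_enorm _).trans_eq ?_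
  refine lintegral_congr fun s => ?_
  have : 0 < max t s := lt_max_of_lt_left ht.1
  simp only
  rw [enorm_mul, ← ofReal_norm, ← ofReal_norm, Real.norm_eq_abs,
    Real.norm_of_nonneg (inv_nonneg.2 this.le)]

theorem ofReal_calderon {f : ℝ → ℝ} (hf : IntegrableOn f (Ioo 0 1)) (hf0 : ∀ s, 0 ≤ f s) {t : ℝ}
    (ht : t ∈ Ioo (0 : ℝ) 1) :
    ENNReal.ofReal (calderon f t) = calderonL (fun s => ENNReal.ofReal (f s)) t := by
  have hn (s : ℝ) : 0 ≤ f s * (max t s)⁻¹ :=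
    mul_nonneg (hf0 s) (inv_nonneg.2 (lt_max_of_lt_left ht.1).le)
  rw [calderon_eq_setIntegral hf ht, ofReal_integral_eq_lintegral_ofReal
    (integrableOn_mul_inv_max hf ht.1) (ae_of_all _ hn)]
  exact lintegral_congr fun s => ENNReal.ofReal_mul (hf0 s)

theorem calderonL_antitoneOn (f : ℝ → ℝ≥0∞) : AntitoneOn (calderonL f) (Ioi 0) :=
  fun _ ha _ _ hab => lintegral_mono fun _ => mul_le_mul_right
    (ENNReal.ofReal_le_ofReal (inv_anti₀ (lt_max_of_lt_left ha) (max_le_max hab le_rfl))) _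

theorem calderonL_ne_top {f : ℝ → ℝ≥0∞} (hf : ∫⁻ s in Ioo (0 : ℝ) 1, f s ≠ ∞) {t : ℝ}
    (ht : 0 < t) : calderonL f t ≠ ∞ := by
  refine ((lintegral_mono fun s => mul_le_mul_right
    (ENNReal.ofReal_le_ofReal (inv_anti₀ ht (le_max_left t s))) _).trans_lt ?_).ne
  rw [lintegral_mul_const' _ _ ENNReal.ofReal_ne_top]
  exact ENNReal.mul_lt_top hf.lt_top ENNReal.ofReal_lt_top

theorem aemeasurable_calderon {x : ℝ → ℝ} (hx : IntegrableOn x (Ioo 0 1)) :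
    AEMeasurable (calderon x) (volume.restrict (Ioo (0 : ℝ) 1)) := by
  have h : AEStronglyMeasurable (fun p : ℝ × ℝ => x p.2 * (max p.1 p.2)⁻¹)
      ((volume.restrict (Ioo (0 : ℝ) 1)).prod (volume.restrict (Ioo (0 : ℝ) 1))) :=
    hx.aestronglyMeasurable.comp_snd.mul
      (Measurable.aestronglyMeasurable (by fun_prop))
  refine h.integral_prod_right'.aemeasurable.congr ?_
  exact (ae_restrict_iff' measurableSet_Ioo).2
    (ae_of_all _ fun t ht => (calderon_eq_setIntegral hx ht).symm)

/-! ### The kernel integrated against a weight -/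

theorem lintegral_Ioi_inv_sq {a : ℝ} (ha : 0 < a) :
    ∫⁻ r in Ioi a, ENNReal.ofReal (r ^ 2)⁻¹ = ENNReal.ofReal a⁻¹ := by
  have hE : EqOn (fun r : ℝ => r ^ (-2 : ℝ)) (fun r => (r ^ 2)⁻¹) (Ioi a) := fun r hr => by
    simp only
    rw [Real.rpow_neg (ha.trans hr).le]
    norm_num
  have hi := (integrableOn_Ioi_rpow_of_lt (a := -2) (by norm_num) ha).congr_fun hE measurableSet_Ioi
  rw [← ofReal_integral_eq_lintegral_ofReal hi (ae_of_all _ fun r => by positivity),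
    ← setIntegral_congr_fun measurableSet_Ioi hE, integral_Ioi_rpow_of_lt (by norm_num) ha]
  congr 1
  norm_num [Real.rpow_neg_one]

theorem measurable_indicator_Iio :
    Measurable fun p : ℝ × ℝ => (Iio p.1).indicator (fun _ => (1 : ℝ≥0∞)) p.2 := by
  have : Measurable fun p : ℝ × ℝ => if p.2 < p.1 then (1 : ℝ≥0∞) else 0 :=
    Measurable.ite (measurableSet_lt measurable_snd measurable_fst) measurable_const
      measurable_const
  exact this

/-- Slicing by `r > max t s` separates the variables: each slice is a product of indicators in `t`
and in `s`. -/
theorem ofReal_inv_max_eq_lintegral {t s : ℝ} (ht : 0 < t) :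
    ENNReal.ofReal (max t s)⁻¹ = ∫⁻ r in Ioi 0, ENNReal.ofReal (r ^ 2)⁻¹ *
      ((Iio r).indicator (fun _ => 1) t * (Iio r).indicator (fun _ => 1) s) := by
  have hm : 0 < max t s := lt_max_of_lt_left ht
  rw [← lintegral_Ioi_inv_sq hm, ← inter_eq_left.2 (Ioi_subset_Ioi hm.le),
    ← setLIntegral_indicator measurableSet_Ioi]
  refine lintegral_congr fun r => ?_
  by_cases h1 : t < r <;> by_cases h2 : s < r <;> simp [indicator, h1, h2]

theorem lintegral_lintegral_inv_max (ν : Measure ℝ) [SFinite ν] (hν : ∀ᵐ t ∂ν, 0 < t) (u : ℝ) :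
    ∫⁻ s in Ioo 0 u, ∫⁻ t, ENNReal.ofReal (max t s)⁻¹ ∂ν
      = ∫⁻ r in Ioi 0, ENNReal.ofReal (r ^ 2)⁻¹ * (ν (Iio r) * volume (Ioo 0 u ∩ Iio r)) := by
  have hi (r : ℝ) : Measurable ((Iio r).indicator (fun _ => (1 : ℝ≥0∞))) :=
    measurable_const.indicator measurableSet_Iio
  have hsq : Measurable fun r : ℝ => ENNReal.ofReal (r ^ 2)⁻¹ := by fun_prop
  have h1 (s : ℝ) : ∫⁻ t, ENNReal.ofReal (max t s)⁻¹ ∂ν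
      = ∫⁻ r in Ioi 0, ENNReal.ofReal (r ^ 2)⁻¹ *
        (ν (Iio r) * (Iio r).indicator (fun _ => 1) s) := by
    rw [lintegral_congr_ae (hν.mono fun t ht => ofReal_inv_max_eq_lintegral (s := s) ht),
      lintegral_lintegral_swap]
    · refine lintegral_congr fun r => ?_
      rw [lintegral_const_mul _ ((hi r).mul_const _), lintegral_mul_const _ (hi r),
        lintegral_indicator_const measurableSet_Iio, one_mul]
    · refine Measurable.aemeasurable ?_
      exact (hsq.comp measurable_snd).mul
        ((measurable_indicator_Iio.comp measurable_swap).mul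
          (measurable_indicator_Iio.comp (measurable_snd.prodMk measurable_const)))
  simp_rw [h1]
  have hν' : Measurable fun r : ℝ => ν (Iio r) :=
    Monotone.measurable fun a b hab => measure_mono (Iio_subset_Iio hab)
  rw [lintegral_lintegral_swap]
  · refine lintegral_congr fun r => ?_
    rw [lintegral_const_mul _ ((hi r).const_mul _), lintegral_const_mul _ (hi r),
      lintegral_indicator_const measurableSet_Iio, one_mul,
      Measure.restrict_apply' measurableSet_Ioo, inter_comm]
  · refine Measurable.aemeasurable ?_
    exact (hsq.comp measurable_snd).mul
      ((hν'.comp measurable_snd).mul (measurable_indicator_Iio.comp measurable_swap))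

theorem lintegral_weightMeasure_inv_max_le {ψ : ℝ → ℝ} (h : IsWeight ψ) {u : ℝ}
    (hu : u ∈ Ioo (0 : ℝ) 1) :
    ∫⁻ s in Ioo 0 u, ∫⁻ t, ENNReal.ofReal (max t s)⁻¹ ∂(weightMeasure ψ h)
      ≤ ((∫⁻ t in Ioo 0 u, ENNReal.ofReal (ψ t / t))
        + ENNReal.ofReal u * (∫⁻ t in Ioo u 1, ENNReal.ofReal (ψ t / t ^ 2)))
        + ENNReal.ofReal u := by
  have hν : ∀ᵐ t ∂(weightMeasure ψ h), 0 < t :=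
    ae_restrict_of_forall_mem measurableSet_Ioo fun t ht => ht.1
  have hvol (r : ℝ) : volume (Ioo 0 u ∩ Iio r) ≤ ENNReal.ofReal u :=
    (measure_mono inter_subset_left).trans (by simp)
  rw [lintegral_lintegral_inv_max _ hν, ← Ioc_union_Ioi_eq_Ioi hu.1.le,
    lintegral_union measurableSet_Ioi Ioc_disjoint_Ioi_same,
    ← Ioc_union_Ioi_eq_Ioi hu.2.le, lintegral_union measurableSet_Ioi Ioc_disjoint_Ioi_same,
    ← add_assoc, ← setLIntegral_congr (Ioo_ae_eq_Ioc (a := (0 : ℝ)) (b := u)),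
    ← setLIntegral_congr (Ioo_ae_eq_Ioc (a := u) (b := 1))]
  -- The ranges `r < u`, `u < r < 1` and `r > 1`: the length of `(0,u) ∩ (-∞,r)` is bounded by `r`,
  -- `u` and `u`, the mass by `ψ(r)`, `ψ(r)` and `1`.
  refine add_le_add (add_le_add ?_ ?_) ?_
  · refine setLIntegral_mono' measurableSet_Ioo fun r hr => ?_
    have hr1 : r ∈ Ioo (0 : ℝ) 1 := ⟨hr.1, hr.2.trans hu.2⟩
    have hψ := (h.mapsTo (Ioo_subset_Ico_self hr1)).1
    calc _ ≤ ENNReal.ofReal (r ^ 2)⁻¹ * (ENNReal.ofReal (ψ r) * ENNReal.ofReal r) := by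
          gcongr
          · exact (weightMeasure_Iio_eq h r).trans_le (weightMeasure_Ioo_le h hr1)
          · calc volume (Ioo 0 u ∩ Iio r) ≤ volume (Ioo 0 r) :=
                  measure_mono fun s hs => ⟨hs.1.1, hs.2⟩
              _ = ENNReal.ofReal r := by simp
      _ = ENNReal.ofReal (ψ r / r) := by
          rw [← ENNReal.ofReal_mul hψ, ← ENNReal.ofReal_mul (by positivity)]
          congr 1
          field_simp [hr.1.ne']
  · rw [← lintegral_const_mul' _ _ ENNReal.ofReal_ne_top]
    refine setLIntegral_mono' measurableSet_Ioo fun r hr => ?_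
    have hr1 : r ∈ Ioo (0 : ℝ) 1 := ⟨hu.1.trans hr.1, hr.2⟩
    have hψ := (h.mapsTo (Ioo_subset_Ico_self hr1)).1
    calc _ ≤ ENNReal.ofReal (r ^ 2)⁻¹ * (ENNReal.ofReal (ψ r) * ENNReal.ofReal u) := by
          gcongr
          · exact (weightMeasure_Iio_eq h r).trans_le (weightMeasure_Ioo_le h hr1)
          · exact hvol r
      _ = ENNReal.ofReal u * ENNReal.ofReal (ψ r / r ^ 2) := by
          rw [← ENNReal.ofReal_mul hψ, ← ENNReal.ofReal_mul (by positivity),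
            ← ENNReal.ofReal_mul hu.1.le]
          congr 1
          ring
  · calc _ ≤ ∫⁻ r in Ioi (1 : ℝ), ENNReal.ofReal (r ^ 2)⁻¹ * ENNReal.ofReal u := by
          refine lintegral_mono fun r => mul_le_mul_right ?_ _
          calc _ ≤ 1 * ENNReal.ofReal u :=
                mul_le_mul' (weightMeasure_Iio_le_one h r) (hvol r)
            _ = _ := one_mul _
      _ = ENNReal.ofReal u := by
          rw [lintegral_mul_const' _ _ ENNReal.ofReal_ne_top, lintegral_Ioi_inv_sq one_pos]
          simp

/-! ### Integrability and the norm estimate for the Calderón operator -/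

theorem setLIntegral_rearr_le_lorentzNorm {φ : ℝ → ℝ} (hφ : IsWeight φ)
    (hconc : ConcaveOn ℝ (Ico 0 1) φ) (h0 : Tendsto φ (𝓝[>] 0) (𝓝 0))
    {A : ℝ} (hA : 0 < A) (hAφ : ∀ u ∈ Ico (0 : ℝ) 1, u ≤ A * φ u) {x : ℝ → ℝ}
    (hx : AEMeasurable x (volume.restrict (Ioo (0 : ℝ) 1))) :
    ∫⁻ s in Ioo (0 : ℝ) 1, ENNReal.ofReal (rearr x s)
      ≤ ENNReal.ofReal A * lorentzNorm φ hφ x := by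
  calc ∫⁻ s in Ioo (0 : ℝ) 1, ENNReal.ofReal (rearr x s)
      ≤ ∫⁻ s in Ioo (0 : ℝ) 1, ENNReal.ofReal (rearr x s)
          ∂(ENNReal.ofReal A • weightMeasure φ hφ) := by
        refine lintegral_rearr_le hx fun u hu => ?_
        rw [Real.volume_Ioo, sub_zero, Measure.smul_apply, smul_eq_mul]
        calc ENNReal.ofReal u ≤ ENNReal.ofReal (A * φ u) :=
              ENNReal.ofReal_le_ofReal (hAφ u (Ioo_subset_Ico_self hu))
          _ = ENNReal.ofReal A * ENNReal.ofReal (φ u) := ENNReal.ofReal_mul hA.le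
          _ ≤ _ := mul_le_mul_right (ofReal_le_weightMeasure_Ioo_of_concaveOn hφ hconc h0 hu) _
    _ = ENNReal.ofReal A * lorentzNorm φ hφ x := by
        rw [Measure.restrict_smul, lintegral_smul_measure, weightMeasure_restrict]
        rfl

theorem integrableOn_of_setLIntegral_rearr {x : ℝ → ℝ}
    (hx : AEMeasurable x (volume.restrict (Ioo (0 : ℝ) 1)))
    (hfin : ∫⁻ s in Ioo (0 : ℝ) 1, ENNReal.ofReal (rearr x s) ≠ ∞) :
    IntegrableOn x (Ioo 0 1) := by
  refine ⟨hx.aestronglyMeasurable, ?_⟩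
  rw [hasFiniteIntegral_iff_norm]
  exact (setLIntegral_abs_le_rearr hx le_rfl).trans_lt hfin.lt_top

/-- Fubini moves the operator from the rearrangement to the measure; the resulting density `K` is
then compared with `C dφ` on initial intervals. -/
theorem lintegral_calderonL_rearr_le {φ ψ : ℝ → ℝ} (hφ : IsWeight φ) (hψ : IsWeight ψ)
    {C : ℝ≥0∞} (hC : ∀ u ∈ Ioo (0 : ℝ) 1,
      ∫⁻ s in Ioo 0 u, ∫⁻ t, ENNReal.ofReal (max t s)⁻¹ ∂(weightMeasure ψ hψ)
        ≤ C * weightMeasure φ hφ (Ioo 0 u))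
    {x : ℝ → ℝ} (hx : AEMeasurable x (volume.restrict (Ioo (0 : ℝ) 1))) :
    ∫⁻ t, calderonL (fun s => ENNReal.ofReal (rearr x s)) t ∂(weightMeasure ψ hψ)
      ≤ C * lorentzNorm φ hφ x := by
  have hF : AEMeasurable (fun s => ENNReal.ofReal (rearr x s))
      (volume.restrict (Ioo (0 : ℝ) 1)) := (aemeasurable_rearr hx volume).ennreal_ofReal
  have hkm : Measurable fun p : ℝ × ℝ => ENNReal.ofReal (max p.1 p.2)⁻¹ := by fun_prop
  set K : ℝ → ℝ≥0∞ := fun s => ∫⁻ t, ENNReal.ofReal (max t s)⁻¹ ∂(weightMeasure ψ hψ) with hK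
  have hKm : Measurable K := hkm.lintegral_prod_left'
  calc ∫⁻ t, calderonL (fun s => ENNReal.ofReal (rearr x s)) t ∂(weightMeasure ψ hψ)
      = ∫⁻ s in Ioo (0 : ℝ) 1, K s * ENNReal.ofReal (rearr x s) := by
        unfold calderonL
        rw [lintegral_lintegral_swap (hF.comp_snd.mul hkm.aemeasurable)]
        refine lintegral_congr fun s => ?_
        rw [lintegral_const_mul' _ _ ENNReal.ofReal_ne_top, mul_comm]
    _ = ∫⁻ s in Ioo (0 : ℝ) 1, ENNReal.ofReal (rearr x s) ∂(volume.withDensity K) := by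
        rw [restrict_withDensity measurableSet_Ioo,
          lintegral_withDensity_eq_lintegral_mul₀ hKm.aemeasurable hF]
        rfl
    _ ≤ ∫⁻ s in Ioo (0 : ℝ) 1, ENNReal.ofReal (rearr x s) ∂(C • weightMeasure φ hφ) := by
        refine lintegral_rearr_le hx fun u hu => ?_
        rw [withDensity_apply _ measurableSet_Ioo]
        exact hC u hu
    _ = C * lorentzNorm φ hφ x := by
        rw [Measure.restrict_smul, lintegral_smul_measure, weightMeasure_restrict]
        rfl

theorem lorentzNorm_calderon_le {ψ : ℝ → ℝ} (hψ : IsWeight ψ) {x : ℝ → ℝ}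
    (hx : AEMeasurable x (volume.restrict (Ioo (0 : ℝ) 1)))
    (hfin : ∫⁻ s in Ioo (0 : ℝ) 1, ENNReal.ofReal (rearr x s) ≠ ∞) :
    lorentzNorm ψ hψ (calderon x)
      ≤ ∫⁻ t, calderonL (fun s => ENNReal.ofReal (rearr x s)) t ∂(weightMeasure ψ hψ) := by
  have hfin' {t : ℝ} (ht : t ∈ Ioo (0 : ℝ) 1) := calderonL_ne_top hfin ht.1
  refine setLIntegral_mono_ae' measurableSet_Ioo (ae_of_all _ fun t ht => ?_)
  rw [ENNReal.ofReal_le_iff_le_toReal (hfin' ht)]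
  refine rearr_le_of_antitoneOn
    (G := fun t => (calderonL (fun s => ENNReal.ofReal (rearr x s)) t).toReal) ?_ ?_ ht
  · exact fun a ha b hb hab => ENNReal.toReal_mono (hfin' ha)
      (calderonL_antitoneOn _ ha.1 hb.1 hab)
  · intro t ht
    rw [← ENNReal.ofReal_le_iff_le_toReal (hfin' ht)]
    exact (ofReal_abs_calderon_le (integrableOn_of_setLIntegral_rearr hx hfin) ht).trans
      (lintegral_abs_mul_inv_max_le hx ht.1)

/-! ### Majorising a single indicator -/

theorem ofReal_one_add_log_le_calderonL {t v : ℝ} (ht : 0 < t) (htv : t ≤ v) (hv : v ≤ 1) :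
    ENNReal.ofReal (1 + Real.log (v / t)) ≤ calderonL ((Iio v).indicator fun _ => 1) t := by
  have hlog : ∫⁻ s in Ioo t v, ENNReal.ofReal s⁻¹ = ENNReal.ofReal (Real.log (v / t)) := by
    have hi : IntegrableOn (fun s : ℝ => s⁻¹) (Ioo t v) := by
      refine ContinuousOn.integrableOn_Icc (fun s hs => ?_) |>.mono_set Ioo_subset_Icc_self
      exact (continuousAt_inv₀ (ht.trans_le hs.1).ne').continuousWithinAt
    rw [← ofReal_integral_eq_lintegral_ofReal hi
      (ae_restrict_of_forall_mem measurableSet_Ioo fun s hs => inv_nonneg.2 (ht.trans hs.1).le),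
      ← integral_Ioc_eq_integral_Ioo, ← intervalIntegral.integral_of_le htv,
      integral_inv_of_pos ht (ht.trans_le htv)]
  have hone : ∫⁻ s in Ioo 0 t, ENNReal.ofReal t⁻¹ = 1 := by
    rw [setLIntegral_const, Real.volume_Ioo, sub_zero, ← ENNReal.ofReal_mul (by positivity),
      inv_mul_cancel₀ ht.ne', ENNReal.ofReal_one]
  have hd : Disjoint (Ioo 0 t) (Ioo t v) :=
    disjoint_left.2 fun s h1 h2 => (h1.2.trans h2.1).false
  calc ENNReal.ofReal (1 + Real.log (v / t))
      = ∫⁻ s in Ioo 0 t ∪ Ioo t v, ENNReal.ofReal (max t s)⁻¹ := by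
        rw [lintegral_union measurableSet_Ioo hd, ENNReal.ofReal_add zero_le_one
          (Real.log_nonneg ((one_le_div ht).2 htv)), ENNReal.ofReal_one, ← hone, ← hlog]
        congr 1
        · exact setLIntegral_congr_fun measurableSet_Ioo fun s hs => by
            simp only [max_eq_left hs.2.le]
        · exact setLIntegral_congr_fun measurableSet_Ioo fun s hs => by
            simp only [max_eq_right hs.1.le]
    _ = ∫⁻ s in Ioo 0 t ∪ Ioo t v,
          (Iio v).indicator (fun _ => 1) s * ENNReal.ofReal (max t s)⁻¹ := by
        refine setLIntegral_congr_fun (measurableSet_Ioo.union measurableSet_Ioo) fun s hs => ?_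
        have : s ∈ Iio v := hs.elim (fun h => h.2.trans_le htv) fun h => h.2
        simp [indicator_of_mem this]
    _ ≤ _ := lintegral_mono_set (union_subset (Ioo_subset_Ioo_right (htv.trans hv))
        (Ioo_subset_Ioo ht.le hv))

theorem ofReal_div_le_calderonL {t v : ℝ} (hv0 : 0 < v) (hvt : v ≤ t) (hv : v ≤ 1) :
    ENNReal.ofReal (v / t) ≤ calderonL ((Iio v).indicator fun _ => 1) t := by
  have ht := hv0.trans_le hvt
  calc ENNReal.ofReal (v / t) = ∫⁻ s in Ioo 0 v, ENNReal.ofReal t⁻¹ := by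
        rw [setLIntegral_const, Real.volume_Ioo, sub_zero, ← ENNReal.ofReal_mul (by positivity),
          inv_mul_eq_div]
    _ = ∫⁻ s in Ioo 0 v, (Iio v).indicator (fun _ => 1) s * ENNReal.ofReal (max t s)⁻¹ := by
        refine setLIntegral_congr_fun measurableSet_Ioo fun s hs => ?_
        have : s ∈ Iio v := hs.2
        simp [indicator_of_mem this, max_eq_left (hs.2.le.trans hvt)]
    _ ≤ _ := lintegral_mono_set (Ioo_subset_Ioo_right hv)

/-- Every admissible `w` is below `1/u`, so `φ(u)/(1 + log(1/u))` bounds the infimum from below.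
Positivity is what allows a choice of `w` within a factor `2` of it. -/
theorem psi_pos {φ : ℝ → ℝ} (h : IsWeight φ) {u : ℝ} (hu : u ∈ Ioo (0 : ℝ) 1) (hφu : 0 < φ u) :
    0 < psi φ u := by
  have hlog : 0 < 1 + Real.log u⁻¹ := by
    have := Real.log_nonneg ((one_le_inv₀ hu.1).2 hu.2.le)
    linarith
  refine (div_pos hφu hlog).trans_le ?_
  obtain ⟨w₀, hw₀⟩ := psi_nonempty (Ioo_subset_Ico_self hu)
  refine le_csInf ⟨_, w₀, hw₀, rfl⟩ ?_
  rintro _ ⟨w, ⟨hw, huw⟩, rfl⟩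
  have h1 : u ≤ u * w := le_mul_of_one_le_right hu.1.le hw.le
  have h2 : φ u ≤ φ (u * w) := h.mono (Ioo_subset_Ico_self hu) ⟨hu.1.le.trans h1, huw⟩ h1
  have h3 : Real.log w ≤ Real.log u⁻¹ := by
    refine Real.log_le_log (by linarith) ?_
    rw [← one_div, le_div_iff₀ hu.1, mul_comm]
    exact huw.le
  exact div_le_div₀ (hφu.le.trans h2) h2 (by linarith [Real.log_pos hw]) (by linarith)

theorem tendsto_psi_zero {φ : ℝ → ℝ} (h : IsWeight φ) (h0 : Tendsto φ (𝓝[>] 0) (𝓝 0)) :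
    Tendsto (psi φ) (𝓝[>] 0) (𝓝 0) := by
  have hmul : Tendsto (fun u : ℝ => u * 2) (𝓝[>] 0) (𝓝[>] 0) := by
    refine tendsto_nhdsWithin_iff.2 ⟨?_, ?_⟩
    · have : Tendsto (fun u : ℝ => u * 2) (𝓝 0) (𝓝 (0 * 2)) := tendsto_id.mul_const 2
      rw [zero_mul] at this
      exact this.mono_left nhdsWithin_le_nhds
    · filter_upwards [self_mem_nhdsWithin] with u hu
      exact mul_pos (mem_Ioi.1 hu) two_pos
  refine tendsto_of_tendsto_of_tendsto_of_le_of_le' tendsto_const_nhds (h0.comp hmul) ?_ ?_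
  · filter_upwards [Ioo_mem_nhdsGT zero_lt_one] with u hu
    exact ((psi_isWeight h).mapsTo (Ioo_subset_Ico_self hu)).1
  · filter_upwards [Ioo_mem_nhdsGT (show (0 : ℝ) < 1 / 2 by norm_num)] with u hu
    have hu2 : u * 2 < 1 := by linarith [hu.2]
    refine (csInf_le (psi_bddBelow h hu.1.le) ⟨2, ⟨one_lt_two, hu2⟩, rfl⟩).trans ?_
    exact div_le_self (h.mapsTo ⟨by linarith [hu.1], hu2⟩).1
      (by linarith [Real.log_pos one_lt_two])

theorem exists_indicator_le_calderonL {φ : ℝ → ℝ} (hφ : IsWeight φ)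
    (h0 : Tendsto φ (𝓝[>] 0) (𝓝 0)) (hpos : ∀ u ∈ Ioo (0 : ℝ) 1, 0 < φ u) {d : ℝ} (hd : d ≤ 1) :
    ∃ v ∈ Ioo (0 : ℝ) 1, ∃ a ≥ 0,
      (∀ t ∈ Ioo 0 d, 1 ≤ ENNReal.ofReal a * calderonL ((Iio v).indicator fun _ => 1) t) ∧
      ENNReal.ofReal (a * φ v) ≤ 4 * weightMeasure (psi φ) (psi_isWeight hφ) (Ioo 0 d) := by
  rcases le_or_gt d 0 with hd0 | hd0
  · refine ⟨1 / 2, by norm_num, 0, le_rfl, ?_, by simp⟩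
    rintro t ⟨h1, h2⟩
    linarith
  -- Working strictly below `d` allows `d = 1` and a jump of `psi φ` at `d`. The ratio `3/4` keeps
  -- `log(t/u) ≤ 1/3` for `t < d`, less than half of `L = 1 + log w > 1`.
  have hu : 3 / 4 * d ∈ Ioo (0 : ℝ) 1 := ⟨by positivity, by linarith⟩
  set u := 3 / 4 * d with hud
  have hψ := psi_pos hφ hu (hpos u hu)
  obtain ⟨w₀, hw₀⟩ := psi_nonempty (Ioo_subset_Ico_self hu)
  obtain ⟨_, ⟨w, ⟨hw, huw⟩, rfl⟩, hlt⟩ := exists_lt_of_csInf_lt (⟨_, w₀, hw₀, rfl⟩ :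
    ((fun w : ℝ => φ (u * w) / (1 + Real.log w)) '' {w : ℝ | 1 < w ∧ u * w < 1}).Nonempty)
    (show psi φ u < 2 * psi φ u by linarith)
  have hw0 : 0 < w := by linarith
  have hv0 : 0 < u * w := mul_pos hu.1 hw0
  have hL : 1 < 1 + Real.log w := by linarith [Real.log_pos hw]
  have hLw : 1 + Real.log w ≤ w := by linarith [Real.log_le_sub_one_of_pos hw0]
  set L := 1 + Real.log w with hLdef
  have hL0 : 0 < L := by linarith
  -- The factor `2` in `2 / L` absorbs the loss from `d` to `u`; the near-optimal choice of `w`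
  -- costs the other `2`.
  refine ⟨u * w, ⟨hv0, huw⟩, 2 / L, by positivity, ?_, ?_⟩
  · rintro t ⟨ht0, htd⟩
    have key {b : ℝ} (hb : L / 2 ≤ b)
        (h : ENNReal.ofReal b ≤ calderonL ((Iio (u * w)).indicator fun _ => 1) t) :
        1 ≤ ENNReal.ofReal (2 / L) * calderonL ((Iio (u * w)).indicator fun _ => 1) t := by
      refine le_trans ?_ (mul_le_mul_right h _)
      rw [← ENNReal.ofReal_mul (by positivity), ENNReal.one_le_ofReal]
      calc (1 : ℝ) = 2 / L * (L / 2) := by field_simp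
        _ ≤ 2 / L * b := by gcongr
    rcases le_total t (u * w) with htv | hvt
    · refine key ?_ (ofReal_one_add_log_le_calderonL ht0 htv huw.le)
      have e : u * w / t = w / (t / u) := by field_simp
      have h1 : Real.log (t / u) ≤ t / u - 1 := Real.log_le_sub_one_of_pos (div_pos ht0 hu.1)
      have h2 : t / u ≤ 4 / 3 := by rw [div_le_iff₀ hu.1]; linarith
      rw [e, Real.log_div hw0.ne' (div_pos ht0 hu.1).ne']
      linarith
    · refine key ?_ (ofReal_div_le_calderonL hv0 hvt huw.le)
      rw [le_div_iff₀ ht0]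
      -- Uses `L ≤ w` and `t < d = 4u/3`.
      nlinarith
  · have h1 : 2 / L * φ (u * w) ≤ 4 * psi φ u := by
      have : φ (u * w) / L < 2 * psi φ u := hlt
      calc 2 / L * φ (u * w) = 2 * (φ (u * w) / L) := by ring
        _ ≤ 4 * psi φ u := by linarith
    calc ENNReal.ofReal (2 / L * φ (u * w)) ≤ ENNReal.ofReal (4 * psi φ u) :=
          ENNReal.ofReal_le_ofReal h1
      _ = 4 * ENNReal.ofReal (psi φ u) := by
          rw [ENNReal.ofReal_mul (by norm_num), ENNReal.ofReal_ofNat]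
      _ ≤ _ := mul_le_mul_right (ofReal_le_weightMeasure_Ioo (psi_isWeight hφ)
          (tendsto_psi_zero hφ h0) hu.1 (by linarith) hd) _

/-! ### Dyadic layers -/

/-- The sum of all powers of two below `r`. -/
def dyadicSum (r : ℝ) : ℝ≥0∞ :=
  ∑' n : ℤ, if (2 : ℝ) ^ n < r then ENNReal.ofReal (2 ^ n) else 0

theorem dyadicSum_eq {r : ℝ} {k : ℤ} (h : r ∈ Ioc ((2 : ℝ) ^ k) (2 ^ (k + 1))) :
    dyadicSum r = ENNReal.ofReal (2 ^ (k + 1)) := by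
  have hlt (n : ℤ) : (2 : ℝ) ^ n < r ↔ n ≤ k := by
    constructor
    · intro hn
      have := (zpow_lt_zpow_iff_right₀ (one_lt_two (α := ℝ))).1 (hn.trans_le h.2)
      omega
    · intro hn
      exact (zpow_le_zpow_right₀ (one_le_two (α := ℝ)) hn).trans_lt h.1
  -- The nonzero terms are those with `n ≤ k`; setting `n = k - m` gives a geometric series.
  have hinj : Function.Injective fun m : ℕ => k - (m : ℤ) := fun a b hab => by
    simp only at hab; omega
  have hsum : HasSum (fun m : ℕ => (2 : ℝ) ^ k * (1 / 2) ^ m) (2 ^ k * 2) :=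
    hasSum_geometric_two.mul_left _
  rw [dyadicSum, ← hinj.tsum_eq]
  · rw [zpow_add_one₀ two_ne_zero, ← hsum.tsum_eq,
      ENNReal.ofReal_tsum_of_nonneg (fun m => by positivity) hsum.summable]
    refine tsum_congr fun m => ?_
    rw [if_pos ((hlt _).2 (by omega)), zpow_sub₀ two_ne_zero]
    simp [div_eq_mul_inv]
  · intro n hn
    have : (2 : ℝ) ^ n < r := by
      by_contra hc
      simp [hc] at hn
    rw [hlt] at this
    exact ⟨(k - n).toNat, by simp only; omega⟩

theorem ofReal_le_dyadicSum (r : ℝ) : ENNReal.ofReal r ≤ dyadicSum r := by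
  rcases le_or_gt r 0 with hr | hr
  · simp [ENNReal.ofReal_of_nonpos hr]
  · obtain ⟨k, hk⟩ := exists_mem_Ioc_zpow hr (one_lt_two (α := ℝ))
    rw [dyadicSum_eq hk]
    exact ENNReal.ofReal_le_ofReal hk.2

theorem dyadicSum_le (r : ℝ) : dyadicSum r ≤ 2 * ENNReal.ofReal r := by
  rcases le_or_gt r 0 with hr | hr
  · have (n : ℤ) : ¬ (2 : ℝ) ^ n < r := not_lt.2 (hr.trans (by positivity))
    simp [dyadicSum, this]
  · obtain ⟨k, hk⟩ := exists_mem_Ioc_zpow hr (one_lt_two (α := ℝ))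
    rw [dyadicSum_eq hk, zpow_add_one₀ two_ne_zero, mul_comm, ENNReal.ofReal_mul two_pos.le,
      ENNReal.ofReal_ofNat]
    exact mul_le_mul_right (ENNReal.ofReal_le_ofReal hk.1.le) _

theorem dyadicSum_rearr {x : ℝ → ℝ} (hx : AEMeasurable x (volume.restrict (Ioo (0 : ℝ) 1)))
    {t : ℝ} (ht : t ∈ Ioo (0 : ℝ) 1) :
    dyadicSum (rearr x t) = ∑' n : ℤ, ENNReal.ofReal (2 ^ n) *
      (Ioo 0 (distr x (2 ^ n)).toReal).indicator (fun _ => 1) t := by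
  refine tsum_congr fun n => ?_
  have h : t ∈ Ioo 0 (distr x (2 ^ n)).toReal ↔ (2 : ℝ) ^ n < rearr x t := by
    rw [← rearr_superlevel hx (by positivity)]
    exact ⟨fun h => h.2, fun h => ⟨ht, h⟩⟩
  by_cases hc : (2 : ℝ) ^ n < rearr x t
  · simp [hc, indicator_of_mem (h.2 hc)]
  · simp [hc, indicator_of_notMem (mt h.1 hc)]

/-! ### Construction of the majorant -/

theorem exists_rearr_le_calderon {φ : ℝ → ℝ} (hφ : IsWeight φ) (hconc : ConcaveOn ℝ (Ico 0 1) φ)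
    (h0 : Tendsto φ (𝓝[>] 0) (𝓝 0)) (hne : ∃ t ∈ Ico (0 : ℝ) 1, φ t ≠ 0) {x : ℝ → ℝ}
    (hx : x ∈ lorentzSpace (psi φ) (psi_isWeight hφ)) :
    ∃ y ∈ lorentzSpace φ hφ,
      (∀ t ∈ Ioo (0 : ℝ) 1, rearr x t ≤ calderon (rearr y) t) ∧
      lorentzNorm φ hφ y ≤ 8 * lorentzNorm (psi φ) (psi_isWeight hφ) x := by
  obtain ⟨A, hA, hAφ⟩ := exists_le_mul_of_concaveOn hφ hconc hne
  have hpos : ∀ u ∈ Ioo (0 : ℝ) 1, 0 < φ u := fun u hu =>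
    pos_of_mul_pos_right (hu.1.trans_le (hAφ u (Ioo_subset_Ico_self hu))) hA.le
  obtain ⟨hxm, hxfin⟩ := hx
  set d : ℤ → ℝ := fun n => (distr x (2 ^ n)).toReal with hdef
  have hd (n : ℤ) : d n ≤ 1 := ENNReal.toReal_le_of_le_ofReal zero_le_one
    (by simpa using distr_le_one x (2 ^ n))
  choose v hv a ha hcal hnorm using fun n => exists_indicator_le_calderonL hφ h0 hpos (hd n)
  set c : ℤ → ℝ≥0∞ := fun n => ENNReal.ofReal (2 ^ n) * ENNReal.ofReal (a n) with hc
  set Y : ℝ → ℝ≥0∞ := fun t => ∑' n, c n * (Iio (v n)).indicator (fun _ => 1) t with hY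
  have hind (n : ℤ) : Measurable ((Iio (v n)).indicator (fun _ => (1 : ℝ≥0∞))) :=
    measurable_const.indicator measurableSet_Iio
  have hYm : Measurable Y := Measurable.tsum fun n => (hind n).const_mul _
  have hYanti : Antitone Y := fun s t hst => ENNReal.tsum_le_tsum fun n => by
    refine mul_le_mul_right ?_ _
    by_cases h : t < v n
    · simp [indicator, h, hst.trans_lt h]
    · simp [indicator, h]
  have hcφ (n : ℤ) : c n * weightMeasure φ hφ (Iio (v n)) ≤ 4 * (ENNReal.ofReal (2 ^ n) *
      weightMeasure (psi φ) (psi_isWeight hφ) (Ioo 0 (d n))) := by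
    calc c n * weightMeasure φ hφ (Iio (v n))
        ≤ ENNReal.ofReal (2 ^ n) * ENNReal.ofReal (a n) * ENNReal.ofReal (φ (v n)) :=
          mul_le_mul_right
            ((weightMeasure_Iio_eq hφ _).trans_le (weightMeasure_Ioo_le hφ (hv n))) _
      _ = ENNReal.ofReal (2 ^ n) * ENNReal.ofReal (a n * φ (v n)) := by
          rw [mul_assoc, ENNReal.ofReal_mul (ha n)]
      _ ≤ ENNReal.ofReal (2 ^ n) * (4 * weightMeasure (psi φ) (psi_isWeight hφ) (Ioo 0 (d n))) :=
          mul_le_mul_right (hnorm n) _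
      _ = _ := mul_left_comm _ _ _
  have hYint : ∫⁻ t, Y t ∂(weightMeasure φ hφ)
      ≤ 8 * lorentzNorm (psi φ) (psi_isWeight hφ) x := by
    calc ∫⁻ t, Y t ∂(weightMeasure φ hφ) = ∑' n, c n * weightMeasure φ hφ (Iio (v n)) := by
          rw [lintegral_tsum fun n => ((hind n).const_mul _).aemeasurable]
          refine tsum_congr fun n => ?_
          rw [lintegral_const_mul _ (hind n), lintegral_indicator_const measurableSet_Iio, one_mul]
      _ ≤ ∑' n : ℤ, 4 * (ENNReal.ofReal (2 ^ n) *
            weightMeasure (psi φ) (psi_isWeight hφ) (Ioo 0 (d n))) := ENNReal.tsum_le_tsum hcφ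
      _ = 4 * ∫⁻ t, dyadicSum (rearr x t) ∂(weightMeasure (psi φ) (psi_isWeight hφ)) := by
          have hm (n : ℤ) : Measurable ((Ioo 0 (d n)).indicator (fun _ => (1 : ℝ≥0∞))) :=
            measurable_const.indicator measurableSet_Ioo
          have he : ∀ᵐ t ∂(weightMeasure (psi φ) (psi_isWeight hφ)), dyadicSum (rearr x t)
              = ∑' n : ℤ, ENNReal.ofReal (2 ^ n) * (Ioo 0 (d n)).indicator (fun _ => 1) t :=
            ae_restrict_of_forall_mem measurableSet_Ioo fun t ht => dyadicSum_rearr hxm ht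
          rw [ENNReal.tsum_mul_left, lintegral_congr_ae he,
            lintegral_tsum fun n => ((hm n).const_mul _).aemeasurable]
          congr 1
          refine tsum_congr fun n => ?_
          rw [lintegral_const_mul _ (hm n), lintegral_indicator_const measurableSet_Ioo, one_mul]
      _ ≤ 4 * ∫⁻ t, 2 * ENNReal.ofReal (rearr x t) ∂(weightMeasure (psi φ) (psi_isWeight hφ)) :=
          mul_le_mul_right (lintegral_mono fun t => dyadicSum_le _) _
      _ = 8 * lorentzNorm (psi φ) (psi_isWeight hφ) x := by
          rw [lintegral_const_mul' _ _ ENNReal.ofNat_ne_top, ← mul_assoc, lorentzNorm]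
          norm_num
  have hYfin : ∫⁻ t, Y t ∂(weightMeasure φ hφ) ≠ ∞ :=
    (hYint.trans_lt (ENNReal.mul_lt_top ENNReal.ofNat_lt_top hxfin)).ne
  -- `Y` is decreasing, so an infinite value at `t` would be infinite on all of `(0,t)`, which has
  -- positive `φ`-mass, against the finite integral.
  have hYtop : ∀ t ∈ Ioo (0 : ℝ) 1, Y t ≠ ∞ := by
    intro t ht htop
    have h1 : Y t * weightMeasure φ hφ (Ioo 0 t) ≤ ∫⁻ s, Y s ∂(weightMeasure φ hφ) := by
      rw [← setLIntegral_const]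
      exact (setLIntegral_mono' measurableSet_Ioo fun s hs => hYanti hs.2.le).trans
        (setLIntegral_le_lintegral _ _)
    have h2 : weightMeasure φ hφ (Ioo 0 t) ≠ 0 :=
      ((ENNReal.ofReal_pos.2 (hpos t ht)).trans_le
        (ofReal_le_weightMeasure_Ioo_of_concaveOn hφ hconc h0 ht)).ne'
    rw [htop, ENNReal.top_mul h2] at h1
    exact hYfin (top_le_iff.1 h1)
  set y : ℝ → ℝ := fun t => (Y t).toReal with hy
  have hym : AEMeasurable y (volume.restrict (Ioo (0 : ℝ) 1)) := hYm.ennreal_toReal.aemeasurable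
  have hyanti : AntitoneOn y (Ioo 0 1) := fun s hs t _ hst =>
    ENNReal.toReal_mono (hYtop s hs) (hYanti hst)
  have hynorm : lorentzNorm φ hφ y ≤ ∫⁻ t, Y t ∂(weightMeasure φ hφ) := by
    refine setLIntegral_mono_ae' measurableSet_Ioo (ae_of_all _ fun t ht => ?_)
    rw [ENNReal.ofReal_le_iff_le_toReal (hYtop t ht)]
    exact rearr_le_of_antitoneOn hyanti (fun s _ => (abs_of_nonneg ENNReal.toReal_nonneg).le) ht
  have hyfin : lorentzNorm φ hφ y < ∞ := hynorm.trans_lt hYfin.lt_top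
  refine ⟨y, ⟨hym, hyfin⟩, fun t ht => ?_, hynorm.trans hYint⟩
  have hrfin : ∫⁻ s in Ioo (0 : ℝ) 1, ENNReal.ofReal (rearr y s) ≠ ∞ :=
    ((setLIntegral_rearr_le_lorentzNorm hφ hconc h0 hA hAφ hym).trans_lt
      (ENNReal.mul_lt_top ENNReal.ofReal_lt_top hyfin)).ne
  have hrint : IntegrableOn (rearr y) (Ioo 0 1) := by
    refine ⟨(aemeasurable_rearr hym volume).aestronglyMeasurable, ?_⟩
    rw [hasFiniteIntegral_iff_ofReal (ae_of_all _ (rearr_nonneg y))]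
    exact hrfin.lt_top
  have hnonneg : 0 ≤ calderon (rearr y) t := by
    rw [calderon_eq_setIntegral hrint ht]
    exact integral_nonneg fun s =>
      mul_nonneg (rearr_nonneg y s) (inv_nonneg.2 (lt_max_of_lt_left ht.1).le)
  rw [← ENNReal.ofReal_le_ofReal_iff hnonneg, ofReal_calderon hrint (rearr_nonneg y) ht]
  have hkm : Measurable fun s : ℝ => ENNReal.ofReal (max t s)⁻¹ := by fun_prop
  calc ENNReal.ofReal (rearr x t) ≤ dyadicSum (rearr x t) := ofReal_le_dyadicSum _
    _ = ∑' n : ℤ, ENNReal.ofReal (2 ^ n) * (Ioo 0 (d n)).indicator (fun _ => 1) t :=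
        dyadicSum_rearr hxm ht
    _ ≤ ∑' n, c n * calderonL ((Iio (v n)).indicator fun _ => 1) t := by
        refine ENNReal.tsum_le_tsum fun n => ?_
        by_cases h : t ∈ Ioo 0 (d n)
        · rw [indicator_of_mem h, hc, mul_assoc]
          exact mul_le_mul_right (hcal n t h) _
        · simp [indicator_of_notMem h]
    _ = calderonL Y t := by
        have e (s : ℝ) : Y s * ENNReal.ofReal (max t s)⁻¹ = ∑' n, c n *
            ((Iio (v n)).indicator (fun _ => 1) s * ENNReal.ofReal (max t s)⁻¹) := by
          rw [hY, ← ENNReal.tsum_mul_right]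
          exact tsum_congr fun n => mul_assoc _ _ _
        have hk (n : ℤ) : Measurable fun s : ℝ =>
            (Iio (v n)).indicator (fun _ => (1 : ℝ≥0∞)) s * ENNReal.ofReal (max t s)⁻¹ :=
          (hind n).mul hkm
        rw [calderonL, lintegral_congr e,
          lintegral_tsum fun n => ((hk n).const_mul _).aemeasurable]
        exact tsum_congr fun n => (lintegral_const_mul _ (hk n)).symm
    _ = calderonL (fun s => ENNReal.ofReal |y s|) t := by
        refine setLIntegral_congr_fun measurableSet_Ioo fun s hs => ?_
        simp only
        rw [hy, abs_of_nonneg ENNReal.toReal_nonneg, ENNReal.ofReal_toReal (hYtop s hs)]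
    -- Hardy–Littlewood replaces `y` by its rearrangement, so equality of the two need not be
    -- proved.
    _ ≤ calderonL (fun s => ENNReal.ofReal (rearr y s)) t :=
        lintegral_abs_mul_inv_max_le hym ht.1

/-! ### Conclusion -/

/-- Boundedness of the Calderón operator under the integral condition on `psi φ`. -/
theorem exists_lorentzNorm_calderon_le {φ : ℝ → ℝ} (hφ : IsWeight φ)
    (hconc : ConcaveOn ℝ (Ico 0 1) φ) (h0 : Tendsto φ (𝓝[>] 0) (𝓝 0))
    (hne : ∃ t ∈ Ico (0 : ℝ) 1, φ t ≠ 0)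
    (hcrit : ∃ c : ℝ, ∀ u ∈ Ioo (0 : ℝ) 1,
      (∫⁻ t in Ioo 0 u, ENNReal.ofReal (psi φ t / t))
        + ENNReal.ofReal u * (∫⁻ t in Ioo u 1, ENNReal.ofReal (psi φ t / t ^ 2))
        ≤ ENNReal.ofReal (c * φ u)) :
    ∃ C : ℝ≥0, ∀ x ∈ lorentzSpace φ hφ,
      IntegrableOn x (Ioo 0 1) volume ∧
      calderon x ∈ lorentzSpace (psi φ) (psi_isWeight hφ) ∧
      lorentzNorm (psi φ) (psi_isWeight hφ) (calderon x) ≤ C * lorentzNorm φ hφ x := by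
  obtain ⟨A, hA, hAφ⟩ := exists_le_mul_of_concaveOn hφ hconc hne
  obtain ⟨c, hc⟩ := hcrit
  -- The constant `c` pays for the two integrals of the hypothesis, and `A` for the extra `u` coming
  -- from `r > 1`.
  have hC : ∀ u ∈ Ioo (0 : ℝ) 1, ∫⁻ s in Ioo 0 u, ∫⁻ t, ENNReal.ofReal (max t s)⁻¹
        ∂(weightMeasure (psi φ) (psi_isWeight hφ))
      ≤ ((c.toNNReal + A.toNNReal : ℝ≥0) : ℝ≥0∞) * weightMeasure φ hφ (Ioo 0 u) := by
    intro u hu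
    have hφu := (hφ.mapsTo (Ioo_subset_Ico_self hu)).1
    calc _ ≤ _ := lintegral_weightMeasure_inv_max_le (psi_isWeight hφ) hu
      _ ≤ ENNReal.ofReal (c * φ u) + ENNReal.ofReal (A * φ u) :=
          add_le_add (hc u hu) (ENNReal.ofReal_le_ofReal (hAφ u (Ioo_subset_Ico_self hu)))
      _ = ((c.toNNReal + A.toNNReal : ℝ≥0) : ℝ≥0∞) * ENNReal.ofReal (φ u) := by
          rw [ENNReal.ofReal_mul' hφu, ENNReal.ofReal_mul' hφu, ← add_mul]
          rfl
      _ ≤ _ := mul_le_mul_right (ofReal_le_weightMeasure_Ioo_of_concaveOn hφ hconc h0 hu) _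
  refine ⟨c.toNNReal + A.toNNReal, fun x hx => ?_⟩
  have hfin : ∫⁻ s in Ioo (0 : ℝ) 1, ENNReal.ofReal (rearr x s) ≠ ∞ :=
    ((setLIntegral_rearr_le_lorentzNorm hφ hconc h0 hA hAφ hx.1).trans_lt
      (ENNReal.mul_lt_top ENNReal.ofReal_lt_top hx.2)).ne
  have hint := integrableOn_of_setLIntegral_rearr hx.1 hfin
  have hle := (lorentzNorm_calderon_le (psi_isWeight hφ) hx.1 hfin).trans
    (lintegral_calderonL_rearr_le hφ (psi_isWeight hφ) hC hx.1)
  exact ⟨hint, ⟨aemeasurable_calderon hint,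
    hle.trans_lt (ENNReal.mul_lt_top ENNReal.coe_lt_top hx.2)⟩, hle⟩

end LorentzCalderon

end

theorem mainTheorem6 (φ : ℝ → ℝ) (hφ : LorentzCalderon.IsWeight φ)
    (hconc : ConcaveOn ℝ (Ico 0 1) φ)
    (hzero : Tendsto φ (𝓝[>] 0) (𝓝 0))
    (hne : ∃ t ∈ Ico (0 : ℝ) 1, φ t ≠ 0)
    (hcrit : ∃ c : ℝ, ∀ u ∈ Ioo (0 : ℝ) 1,
      (∫⁻ t in Ioo 0 u, ENNReal.ofReal (LorentzCalderon.psi φ t / t))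
        + ENNReal.ofReal u
          * (∫⁻ t in Ioo u 1, ENNReal.ofReal (LorentzCalderon.psi φ t / t ^ 2))
        ≤ ENNReal.ofReal (c * φ u)) :
    (∃ C : ℝ≥0, ∀ x ∈ LorentzCalderon.lorentzSpace φ hφ,
      IntegrableOn x (Ioo 0 1) volume ∧
      LorentzCalderon.calderon x ∈
        LorentzCalderon.lorentzSpace (LorentzCalderon.psi φ) (LorentzCalderon.psi_isWeight hφ) ∧
      LorentzCalderon.lorentzNorm (LorentzCalderon.psi φ) (LorentzCalderon.psi_isWeight hφ)
          (LorentzCalderon.calderon x)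
        ≤ C * LorentzCalderon.lorentzNorm φ hφ x) ∧
    (∀ x ∈ LorentzCalderon.lorentzSpace (LorentzCalderon.psi φ) (LorentzCalderon.psi_isWeight hφ),
      ∃ y ∈ LorentzCalderon.lorentzSpace φ hφ,
        (∀ t ∈ Ioo (0 : ℝ) 1,
          LorentzCalderon.rearr x t ≤ LorentzCalderon.calderon (LorentzCalderon.rearr y) t) ∧
        LorentzCalderon.lorentzNorm φ hφ y
          ≤ 8 * LorentzCalderon.lorentzNorm (LorentzCalderon.psi φ)
              (LorentzCalderon.psi_isWeight hφ) x) :=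
  ⟨LorentzCalderon.exists_lorentzNorm_calderon_le hφ hconc hzero hne hcrit,
    fun _ hx => LorentzCalderon.exists_rearr_le_calderon hφ hconc hzero hne hx⟩
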